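/- For $p\ge 3$ let $Q$ be the simple random walk kernel on the circle $\mathbb Z/p\mathbb Z$, i.e. $Q(x,y)=1/2$ if $y=x\pm1$ and $Q(x,y)=0$ otherwise. For $\delta\in(-1/2,1/2)$ let $Q_\delta=Q+\Delta_\delta$, where $\Delta_\delta(0,1)=\delta$, $\Delta_\delta(0,-1)=-\delta$ and $\Delta_\delta(x,y)=0$ otherwise. For $\varepsilon\in(0,1/2)$ put $\mathcal Q(\varepsilon)=\{Q_\delta:\delta\in[-\varepsilon,\varepsilon]\}$ and $\mathcal Q_{\mathrm{lazy}}(\varepsilon)=\{\tfrac12(I+K):K\in\mathcal Q(\varepsilon)\}$. For a sequence $(K_i)_{i\ge1}$ of Markov kernels on a finite set $V$ write $K_{0,n}=K_1K_2\cdots K_n$, and let $\|\mu-\nu\|_{\mathrm{TV}}=\sup_{A\subset V}\{\mu(A)-\nu(A)\}$. A family $\mathcal Q$ of Markov kernels on $V$ has total variation $\eta$-merging time at most $T$ if for every sequence with $K_i\in\mathcal Q$ for all $i\ge 1$ one has $$\inf\Bigl\{n:\max_{x,y\in V}\|K_{0,n}(x,\cdot)-K_{0,n}(y,\cdot)\|_{\mathrm{TV}}<\eta\Bigr\}\le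 T$$ and, for every integer $t>T$, $\max_{x,y\in V}\|K_{0,t}(x,\cdot)-K_{0,t}(y,\cdot)\|_{\mathrm{TV}}\le\eta$. Write $\log_+ s=\max\{0,\log s\}$. **Theorem.** Fix $\varepsilon\in(0,1/2)$. There is a constant $B(\varepsilon)\in(0,\infty)$, depending only on $\varepsilon$, such that the following holds for every $\eta>0$ and for the family $\mathcal Q_{\mathrm{lazy}}(\varepsilon)$ on $V_N=\mathbb Z/2N\mathbb Z$ for every $N\ge2$ [resp., the family $\mathcal Q(\varepsilon)$ on $V_N=\mathbb Z/(2N+1)\mathbb Z$ for every $N\ge1$]. 1. The family has total variation $\eta$-merging time at most $B(\varepsilon)N^2(1+\log_+ 1/\eta)$. 2. For any sequence $(K_i)_{i\ge1}$ with $K_i\in\mathcal Q_{\mathrm{lazy}}(\varepsilon)$ [resp., $K_i\in\mathcal Q(\varepsilon)$] for all $i\ge1$, $$\forall n\ge B(\varepsilon)N^2(1+\log_+ 1/\eta):\qquad \max_{x,y,z\in V_N}\left|\frac{K_{0,n}(x,z)}{K_{0,n}(y,z)}-1\right|\le\eta,$$ with the conventions $0/0=1$ and $a/0=\infty$ for $a>0$.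 -/

import Mathlib

open scoped ENNReal

noncomputable section

namespace CircleMerging

/-! ### Time inhomogeneous chains and merging

A kernel on a finite set `V` is given by its matrix `K x y` (rows sum to one). A sequence
`K 1, K 2, …` of kernels is a function on `ℕ`; the value `K 0` is never used. -/

section Merging

variable {V : Type*} [Fintype V] [DecidableEq V]

/-- `stepProd K n` is the `n`-step kernel `K_{0,n} = K_1 K_2 ⋯ K_n` (the identity if `n = 0`). -/
def stepProd (K : ℕ → Matrix V V ℝ) : ℕ → Matrix V V ℝ
  | 0 => 1
  | n + 1 => stepProd K n * K (n + 1)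

/-- Total variation distance `sup_{A ⊆ V} (μ(A) - ν(A))`. -/
def tvDist (μ ν : V → ℝ) : ℝ :=
  ⨆ A : Finset V, (∑ x ∈ A, μ x - ∑ x ∈ A, ν x)

/-- `max_{x,y} ‖K_{0,n}(x,·) - K_{0,n}(y,·)‖_TV`. -/
def maxTV (K : ℕ → Matrix V V ℝ) (n : ℕ) : ℝ :=
  ⨆ x : V, ⨆ y : V, tvDist (stepProd K n x) (stepProd K n y)

/-- `|a / b - 1|` for `a, b ≥ 0`, with the conventions `0 / 0 = 1` and `a / 0 = ∞` for `a > 0`. -/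
def relDev (a b : ℝ) : ℝ≥0∞ :=
  if b = 0 then (if a = 0 then 0 else ⊤) else ENNReal.ofReal |a / b - 1|

/-- `max_{x,y,z} |K_{0,n}(x,z) / K_{0,n}(y,z) - 1|`. -/
def maxRelDev (K : ℕ → Matrix V V ℝ) (n : ℕ) : ℝ≥0∞ :=
  ⨆ x : V, ⨆ y : V, ⨆ z : V, relDev (stepProd K n x z) (stepProd K n y z)

/-- The max total variation `η`-merging time of a sequence of kernels,
`inf {n : maxTV K n < η}`, equal to `∞` if there is no such `n`. -/
def tvMergingTime (K : ℕ → Matrix V V ℝ) (η : ℝ) : ℝ≥0∞ :=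
  ⨅ (n : ℕ) (_ : maxTV K n < η), (n : ℝ≥0∞)

/-- The family `𝒬` of kernels has max total variation `η`-merging time at most `T`: every sequence
drawn from `𝒬` has merging time at most `T`, and stays `η`-merged at all times `t > T`. -/
def HasTVMergingTimeAtMost (𝒬 : Set (Matrix V V ℝ)) (η T : ℝ) : Prop :=
  ∀ K : ℕ → Matrix V V ℝ, (∀ i, 1 ≤ i → K i ∈ 𝒬) →
    tvMergingTime K η ≤ ENNReal.ofReal T ∧ ∀ t : ℕ, T < (t : ℝ) → maxTV K t ≤ η

end Merging

/-! ### Perturbed walks on the circle `ℤ/pℤ` -/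

section Circle

variable (p : ℕ)

/-- The simple random walk on the circle `ℤ/pℤ`, `p ≥ 3`: `1/2` to each of the two neighbours. -/
def srw : Matrix (ZMod p) (ZMod p) ℝ :=
  fun x y => if y = x + 1 ∨ y = x - 1 then 1 / 2 else 0

/-- The asymmetric perturbation at vertex `0`: `δ` at `(0,1)`, `-δ` at `(0,-1)`. -/
def perturbation (δ : ℝ) : Matrix (ZMod p) (ZMod p) ℝ :=
  fun x y => if x = 0 ∧ y = 1 then δ else if x = 0 ∧ y = -1 then -δ else 0

/-- `Q_δ = Q + Δ_δ`. -/
def perturbedWalk (δ : ℝ) : Matrix (ZMod p) (ZMod p) ℝ :=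
  srw p + perturbation p δ

/-- `𝒬(ε) = {Q_δ : δ ∈ [-ε, ε]}`. -/
def family (ε : ℝ) : Set (Matrix (ZMod p) (ZMod p) ℝ) :=
  {K | ∃ δ ∈ Set.Icc (-ε) ε, K = perturbedWalk p δ}

/-- `𝒬_lazy(ε) = {(I + K) / 2 : K ∈ 𝒬(ε)}`. -/
def lazyFamily (ε : ℝ) : Set (Matrix (ZMod p) (ZMod p) ℝ) :=
  {L | ∃ K ∈ family p ε, L = (1 / 2 : ℝ) • (1 + K)}

end Circle

/-- The time bound `B N² (1 + log₊ (1/η))`. -/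
def timeBound (B : ℝ) (N : ℕ) (η : ℝ) : ℝ :=
  B * (N : ℝ) ^ 2 * (1 + Real.posLog (1 / η))

end CircleMerging

end

open scoped ENNReal

noncomputable section

namespace CircleMerging

/-! ### The symmetric walk on the circle, with holding probability `1 - r` -/

section SymmetricWalk

variable {p : ℕ}

/-! The perturbation at `0` is odd under `x ↦ -x`. For a row `ν n` of `K_{0,n}`, the symmetrization
`ν n x + ν n (-x)` therefore evolves by the unperturbed walk, whatever the `δ`s are
(`orbit_add_neg`). The Fourier bound for that walk then gives the upper bound `ν n ≤ 3 / p` after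
order `p²` steps.

For the lower bound, split the symmetrized mass into the part killed at `0` and the part that has
visited `0`. The true chain keeps at least a fraction `1 / 2 - ε` of the second part at every point
(`le_orbit`), because at `0` the symmetrization is exactly `2 ν n 0`, which leaves room for the
perturbation. The killed part decays on the time scale `p²`, by the supersolution `hittingWeight`.

Hence every product of order `p²` kernels has all its entries between two constant multiples of `1 /
p` (`orbit_bounds`). Doeblin contraction over successive blocks gives total variation merging, and
one extra block turns it into relative merging (`maxTV_le_and_maxRelDev_le`). The lazy even and
non-lazy odd cases differ only in the spectral sum. -/

/-- One step of the symmetric walk on the circle that moves with probability `r`. -/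
def symStep (r : ℝ) (f : ZMod p → ℝ) : ZMod p → ℝ :=
  fun x => (1 - r) * f x + r * ((f (x + 1) + f (x - 1)) / 2)

/-- The eigenvalues of `symStep`. -/
def symEigenvalue (r : ℝ) (k : ZMod p) : ℝ :=
  (1 - r) + r * Real.cos (2 * Real.pi * k.val / p)

lemma symStep_mono {r : ℝ} (h0 : 0 ≤ r) (h1 : r ≤ 1) {f g : ZMod p → ℝ} (h : ∀ x, f x ≤ g x)
    (x : ZMod p) : symStep r f x ≤ symStep r g x := by
  unfold symStep
  have := h x
  have := h (x + 1)
  have := h (x - 1)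
  have : 0 ≤ 1 - r := by linarith
  gcongr

lemma symStep_nonneg {r : ℝ} (h0 : 0 ≤ r) (h1 : r ≤ 1) {f : ZMod p → ℝ} (h : ∀ x, 0 ≤ f x)
    (x : ZMod p) : 0 ≤ symStep r f x := by
  have := symStep_mono h0 h1 (f := fun _ => 0) h x
  simpa [symStep] using this

lemma iterate_symStep_nonneg {r : ℝ} (h0 : 0 ≤ r) (h1 : r ≤ 1) {f : ZMod p → ℝ}
    (h : ∀ x, 0 ≤ f x) (n : ℕ) (x : ZMod p) : 0 ≤ (symStep r)^[n] f x := by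
  induction n generalizing x with
  | zero => exact h x
  | succ n ih =>
    rw [Function.iterate_succ_apply']
    exact symStep_nonneg h0 h1 ih x

variable [NeZero p]

lemma sum_mul_symStep (r : ℝ) (f g : ZMod p → ℝ) :
    ∑ x, f x * symStep r g x = ∑ x, symStep r f x * g x := by
  have e1 : ∑ x, f x * g (x + 1) = ∑ x, f (x - 1) * g x :=
    Fintype.sum_equiv (Equiv.addRight 1) _ _ (by simp)
  have e2 : ∑ x, f x * g (x - 1) = ∑ x, f (x + 1) * g x :=
    Fintype.sum_equiv (Equiv.subRight 1) _ _ (by simp)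
  have l : ∀ x, f x * symStep r g x =
      (1 - r) * (f x * g x) + r / 2 * (f x * g (x + 1)) + r / 2 * (f x * g (x - 1)) := by
    intro x; unfold symStep; ring
  have l' : ∀ x, symStep r f x * g x =
      (1 - r) * (f x * g x) + r / 2 * (f (x - 1) * g x) + r / 2 * (f (x + 1) * g x) := by
    intro x; unfold symStep; ring
  simp_rw [l, l', Finset.sum_add_distrib, ← Finset.mul_sum, e1, e2]

lemma stdAddChar_add_stdAddChar_neg (k : ZMod p) :
    ZMod.stdAddChar k + ZMod.stdAddChar (-k) =
      ((2 * Real.cos (2 * Real.pi * k.val / p) : ℝ) : ℂ) := by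
  have h1 : ∀ j : ZMod p, (ZMod.stdAddChar j : ℂ) =
      Complex.exp ((2 * Real.pi * j.val / p : ℝ) * Complex.I) := by
    intro j
    rw [ZMod.stdAddChar_apply, ZMod.toCircle_apply]
    congr 1
    push_cast
    ring
  rw [AddChar.map_neg_eq_inv, h1, ← Complex.exp_neg, ← neg_mul, Complex.ofReal_mul,
    Complex.ofReal_cos, Complex.ofReal_ofNat, Complex.two_cos]

lemma norm_stdAddChar (k : ZMod p) : ‖(ZMod.stdAddChar k : ℂ)‖ = 1 := by
  rw [ZMod.stdAddChar_apply]; exact Circle.norm_coe _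

/-- Additive characters diagonalize `symStep`; the case `n = 0` is Fourier inversion. -/
lemma iterate_symStep_eq_fourier (r : ℝ) (f : ZMod p → ℝ) (n : ℕ) (x : ZMod p) :
    (((symStep r)^[n] f x : ℝ) : ℂ) = (1 / p : ℂ) * ∑ k : ZMod p,
      (symEigenvalue r k : ℂ) ^ n * ZMod.stdAddChar (k * x) *
        ∑ y, (f y : ℂ) * ZMod.stdAddChar (-(k * y)) := by
  have hp : (p : ℂ) ≠ 0 := by exact_mod_cast NeZero.ne p
  induction n generalizing x with
  | zero =>
    have h : ∀ y : ZMod p, ∑ k : ZMod p, ZMod.stdAddChar (k * (x - y)) =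
        if x = y then (p : ℂ) else 0 := by
      intro y
      have := AddChar.sum_mulShift (x - y) (ZMod.isPrimitive_stdAddChar p)
      rw [this]
      simp [sub_eq_zero, ZMod.card]
    simp_rw [Function.iterate_zero, id, pow_zero, one_mul, Finset.mul_sum]
    rw [Finset.sum_comm]
    have h2 : ∀ y : ZMod p, ∑ k : ZMod p, (1 / p : ℂ) * (ZMod.stdAddChar (k * x) *
        ((f y : ℂ) * ZMod.stdAddChar (-(k * y)))) = if x = y then (f y : ℂ) else 0 := by
      intro y
      have : ∀ k : ZMod p, (1 / p : ℂ) * (ZMod.stdAddChar (k * x) *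
        ((f y : ℂ) * ZMod.stdAddChar (-(k * y)))) =
          (f y / p : ℂ) * ZMod.stdAddChar (k * (x - y)) := by
        intro k
        rw [mul_sub, sub_eq_add_neg, AddChar.map_add_eq_mul]
        ring
      simp_rw [this, ← Finset.mul_sum, h]
      split_ifs
      · field_simp
      · simp
    simp_rw [h2]
    simp
  | succ n ih =>
    rw [Function.iterate_succ_apply']
    unfold symStep
    push_cast
    change (1 - (r : ℂ)) * ((symStep r)^[n] f x : ℝ) +
      r * ((((symStep r)^[n] f (x + 1) : ℝ) + ((symStep r)^[n] f (x - 1) : ℝ)) / 2) = _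
    rw [ih, ih, ih]
    simp_rw [Finset.mul_sum (a := (1 / p : ℂ))]
    rw [← Finset.sum_add_distrib, Finset.mul_sum, Finset.sum_div, Finset.mul_sum,
      ← Finset.sum_add_distrib]
    refine Finset.sum_congr rfl fun k _ => ?_
    have hk := stdAddChar_add_stdAddChar_neg k
    rw [mul_add, mul_sub, mul_one, sub_eq_add_neg (k * x), AddChar.map_add_eq_mul,
      AddChar.map_add_eq_mul]
    have : (symEigenvalue r k : ℂ) =
        (1 - r) + r * ((ZMod.stdAddChar k + ZMod.stdAddChar (-k)) / 2) := by
      rw [hk]; unfold symEigenvalue; push_cast; ring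
    rw [pow_succ]
    generalize (symEigenvalue r k : ℂ) ^ n = A
    rw [this]
    ring

/-- The frequency `k = 0` contributes the mean, and each Fourier coefficient of `f ≥ 0` is at most
its total mass. -/
lemma abs_iterate_symStep_sub_le (r : ℝ) {f : ZMod p → ℝ} (hf : ∀ x, 0 ≤ f x) (n : ℕ)
    (x : ZMod p) :
    |(symStep r)^[n] f x - (∑ y, f y) / p| ≤
      (∑ y, f y) / p * ∑ k ∈ Finset.univ.erase (0 : ZMod p), |symEigenvalue r k| ^ n := by
  have hp : (p : ℂ) ≠ 0 := by exact_mod_cast NeZero.ne p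
  have h := iterate_symStep_eq_fourier r f n x
  rw [← Finset.add_sum_erase _ _ (Finset.mem_univ (0 : ZMod p))] at h
  have h0 : symEigenvalue r (0 : ZMod p) = 1 := by simp [symEigenvalue]
  simp only [h0, zero_mul, neg_zero, AddChar.map_zero_eq_one, Complex.ofReal_one, one_pow,
    one_mul, mul_one, mul_add] at h
  have h2 : (((symStep r)^[n] f x - (∑ y, f y) / p : ℝ) : ℂ) = (1 / p : ℂ) *
      ∑ k ∈ Finset.univ.erase (0 : ZMod p), (symEigenvalue r k : ℂ) ^ n *
        ZMod.stdAddChar (k * x) * ∑ y, (f y : ℂ) * ZMod.stdAddChar (-(k * y)) := by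
    push_cast
    rw [h]
    ring
  have hF : ∀ k : ZMod p, ‖∑ y, (f y : ℂ) * ZMod.stdAddChar (-(k * y))‖ ≤ ∑ y, f y := by
    intro k
    refine (norm_sum_le _ _).trans (Finset.sum_le_sum fun y _ => ?_)
    rw [norm_mul, norm_stdAddChar, mul_one, Complex.norm_real, Real.norm_of_nonneg (hf y)]
  rw [← Real.norm_eq_abs, ← Complex.norm_real, h2, norm_mul, norm_div, norm_one,
    Complex.norm_natCast]
  calc _ ≤ (1 / p : ℝ) * ∑ k ∈ Finset.univ.erase (0 : ZMod p),
        |symEigenvalue r k| ^ n * ∑ y, f y := by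
        gcongr
        refine (norm_sum_le _ _).trans (Finset.sum_le_sum fun k _ => ?_)
        rw [norm_mul, norm_mul, norm_stdAddChar, mul_one, norm_pow, Complex.norm_real,
          Real.norm_eq_abs]
        gcongr
        exact hF k
    _ = _ := by rw [← Finset.sum_mul]; ring

end SymmetricWalk

/-! ### The spectral sum -/

lemma abs_cos_pow_le_of_two_mul_le {p v n : ℕ} (hv : 1 ≤ v) (hvp : 2 * v ≤ p)
    (hn : 16 * p ^ 2 ≤ n) :
    |Real.cos (Real.pi * v / p)| ^ n ≤ (1 / 8 : ℝ) ^ v := by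
  have hp : (0 : ℝ) < p := by
    have : 0 < p := by omega
    exact_mod_cast this
  have hv' : (1 : ℝ) ≤ v := by exact_mod_cast hv
  have hvp' : 2 * (v : ℝ) ≤ p := by exact_mod_cast hvp
  have hn' : 16 * (p : ℝ) ^ 2 ≤ n := by exact_mod_cast hn
  have hpi := Real.pi_pos
  have hx0 : 0 ≤ Real.pi * v / p := by positivity
  have hx1 : Real.pi * v / p ≤ Real.pi / 2 := by
    rw [div_le_div_iff₀ hp two_pos]; nlinarith
  have hc0 : 0 ≤ Real.cos (Real.pi * v / p) :=
    Real.cos_nonneg_of_neg_pi_div_two_le_of_le (by linarith) hx1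
  have hc := Real.cos_le_one_sub_mul_cos_sq (x := Real.pi * v / p)
    (by rw [abs_of_nonneg hx0]; linarith)
  have hc2 : Real.cos (Real.pi * v / p) ≤ Real.exp (-(2 * v ^ 2 / p ^ 2)) := by
    refine hc.trans ?_
    have := Real.add_one_le_exp (-(2 * v ^ 2 / p ^ 2 : ℝ))
    refine le_trans (le_of_eq ?_) this
    field_simp
    ring
  rw [abs_of_nonneg hc0]
  have h8 : Real.exp (-32) ≤ 1 / 8 := by
    rw [Real.exp_neg, one_div]
    have := Real.add_one_le_exp (32 : ℝ)
    gcongr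
    linarith
  calc Real.cos (Real.pi * v / p) ^ n ≤ Real.exp (-(2 * v ^ 2 / p ^ 2)) ^ n := by gcongr
    _ = Real.exp (-(n * (2 * v ^ 2 / p ^ 2))) := by rw [← Real.exp_nat_mul]; ring_nf
    -- The time `16 p²` turns the exponent into at least `32 v²`, and `v² ≥ v`, so the sum over
    -- frequencies becomes geometric.
    _ ≤ Real.exp (v * -32) := by
      apply Real.exp_le_exp.2
      have h1 : (32 : ℝ) * v ^ 2 ≤ n * (2 * v ^ 2 / p ^ 2) := by
        rw [mul_div_assoc', le_div_iff₀ (by positivity)]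
        nlinarith [sq_nonneg (v : ℝ)]
      nlinarith
    _ = Real.exp (-32) ^ v := Real.exp_nat_mul _ _
    _ ≤ _ := by gcongr

/-- The reflection `v ↦ p - v` preserves `|cos|`; keeping both terms avoids splitting the later sum
at `p / 2`. -/
lemma abs_cos_pow_le {p v n : ℕ} (hv : 1 ≤ v) (hvp : v < p) (hn : 16 * p ^ 2 ≤ n) :
    |Real.cos (Real.pi * v / p)| ^ n ≤ (1 / 8 : ℝ) ^ v + (1 / 8 : ℝ) ^ (p - v) := by
  rcases le_total (2 * v) p with h | h
  · exact (abs_cos_pow_le_of_two_mul_le hv h hn).trans (le_add_of_nonneg_right (by positivity))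
  · have h2 := abs_cos_pow_le_of_two_mul_le (v := p - v) (by omega) (by omega) hn
    have hp : (p : ℝ) ≠ 0 := by
      have : p ≠ 0 := by omega
      exact_mod_cast this
    have e : Real.pi * ((p - v : ℕ) : ℝ) / p = Real.pi - Real.pi * v / p := by
      rw [Nat.cast_sub hvp.le]; field_simp
    rw [e, Real.cos_pi_sub, abs_neg] at h2
    exact h2.trans (le_add_of_nonneg_left (by positivity))

lemma sum_abs_cos_pow_le {p : ℕ} [NeZero p] {n : ℕ} (hn : 16 * p ^ 2 ≤ n) :
    ∑ k ∈ Finset.univ.erase (0 : ZMod p), |Real.cos (Real.pi * k.val / p)| ^ n ≤ 1 / 2 := by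
  have hgeom : ∑ v ∈ Finset.range (p - 1), (1 / 8 : ℝ) ^ (v + 1) ≤ 1 / 7 := by
    have := geom_sum_eq (x := (1 / 8 : ℝ)) (by norm_num) (p - 1)
    simp_rw [pow_succ]
    rw [← Finset.sum_mul, this]
    have : (0 : ℝ) ≤ (1 / 8) ^ (p - 1) := by positivity
    rw [show (1 / 8 - 1 : ℝ) = -(7 / 8) by norm_num]
    linarith
  have hinj : ∑ k ∈ Finset.univ.erase (0 : ZMod p), |Real.cos (Real.pi * k.val / p)| ^ n =
      ∑ v ∈ Finset.range (p - 1), |Real.cos (Real.pi * ((v + 1 : ℕ) : ℝ) / p)| ^ n := by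
    symm
    refine Finset.sum_bij (fun v _ => ((v + 1 : ℕ) : ZMod p)) ?_ ?_ ?_ ?_
    · intro v hv
      rw [Finset.mem_range] at hv
      simp only [Finset.mem_erase, Finset.mem_univ, and_true]
      intro h
      have := congrArg ZMod.val h
      rw [ZMod.val_cast_of_lt (by omega), ZMod.val_zero] at this
      omega
    · intro a ha b hb h
      rw [Finset.mem_range] at ha hb
      have := congrArg ZMod.val h
      rw [ZMod.val_cast_of_lt (by omega), ZMod.val_cast_of_lt (by omega)] at this
      omega
    · intro k hk
      have h1 := ZMod.val_lt k
      have h2 : k.val ≠ 0 := by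
        rw [Ne, ZMod.val_eq_zero]; exact (Finset.mem_erase.1 hk).1
      refine ⟨k.val - 1, Finset.mem_range.2 (by omega), ?_⟩
      rw [Nat.sub_add_cancel (by omega), ZMod.natCast_zmod_val]
    · intro v hv
      rw [Finset.mem_range] at hv
      rw [ZMod.val_cast_of_lt (by omega)]
  rw [hinj]
  calc _ ≤ ∑ v ∈ Finset.range (p - 1),
        ((1 / 8 : ℝ) ^ (v + 1) + (1 / 8 : ℝ) ^ (p - 1 - 1 - v + 1)) := by
        refine Finset.sum_le_sum fun v hv => ?_
        rw [Finset.mem_range] at hv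
        have e : p - 1 - 1 - v + 1 = p - (v + 1) := by omega
        rw [e]
        exact abs_cos_pow_le (by omega) (by omega) hn
    _ ≤ 1 / 7 + 1 / 7 := by
        rw [Finset.sum_add_distrib,
          Finset.sum_range_reflect (fun v => (1 / 8 : ℝ) ^ (v + 1)) (p - 1)]
        linarith
    _ ≤ 1 / 2 := by norm_num

/-- By the half-angle formula the lazy eigenvalues are `cos² (π k / p)`. -/
lemma sum_abs_symEigenvalue_pow_le_of_lazy {p : ℕ} [NeZero p] {n : ℕ} (hn : 16 * p ^ 2 ≤ n) :
    ∑ k ∈ Finset.univ.erase (0 : ZMod p), |symEigenvalue (1 / 2) k| ^ n ≤ 1 / 2 := by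
  refine le_trans (Finset.sum_le_sum fun k _ => ?_) (sum_abs_cos_pow_le hn)
  have e : symEigenvalue (1 / 2) k = |Real.cos (Real.pi * k.val / p)| ^ 2 := by
    rw [sq_abs, Real.cos_sq, symEigenvalue]
    ring_nf
  rw [e, abs_of_nonneg (by positivity)]
  gcongr
  exact pow_le_of_le_one (abs_nonneg _) (Real.abs_cos_le_one _) two_ne_zero

/-- For odd `p`, doubling permutes the nonzero residues, so the numbers `|cos (2 π k / p)|`
rearrange the numbers `|cos (π k / p)|`. -/
lemma sum_abs_symEigenvalue_pow_le_of_odd {p : ℕ} [NeZero p] (hp : Odd p) {n : ℕ}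
    (hn : 16 * p ^ 2 ≤ n) :
    ∑ k ∈ Finset.univ.erase (0 : ZMod p), |symEigenvalue 1 k| ^ n ≤ 1 / 2 := by
  have hu : IsUnit (2 : ZMod p) := by
    have := (ZMod.isUnit_iff_coprime 2 p).2 (Nat.coprime_two_left.2 hp)
    exact_mod_cast this
  have hp0 : (p : ℝ) ≠ 0 := by exact_mod_cast NeZero.ne p
  refine le_trans (le_of_eq ?_) (sum_abs_cos_pow_le hn)
  refine Finset.sum_bij (fun k _ => 2 * k) ?_ ?_ ?_ ?_
  · intro k hk
    simp only [Finset.mem_erase, Finset.mem_univ, and_true] at hk ⊢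
    rwa [Ne, hu.mul_right_eq_zero]
  · intro a _ b _ h
    exact hu.mul_left_cancel h
  · intro k hk
    obtain ⟨u, hu⟩ := hu
    refine ⟨↑u⁻¹ * k, ?_, ?_⟩
    · simp only [Finset.mem_erase, Finset.mem_univ, and_true] at hk ⊢
      rwa [Ne, Units.mul_right_eq_zero]
    · rw [← hu, Units.mul_inv_cancel_left]
  · intro k _
    congr 1
    have hv := ZMod.val_lt k
    rw [two_mul, ZMod.val_add, symEigenvalue]
    rcases lt_or_ge (k.val + k.val) p with h | h
    · rw [Nat.mod_eq_of_lt h]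
      push_cast
      ring_nf
    -- Wrapping around shifts the angle by `π`, which changes only the sign of the cosine.
    · rw [Nat.mod_eq_sub_mod h, Nat.mod_eq_of_lt (by omega), Nat.cast_sub h]
      have e : Real.pi * (((k.val + k.val : ℕ) : ℝ) - p) / p =
          2 * Real.pi * k.val / p - Real.pi := by
        push_cast; field_simp; ring
      rw [e, Real.cos_sub_pi, abs_neg]
      ring_nf

/-! ### The perturbed walk -/

section PerturbedStep

variable {p : ℕ}

/-- The action on row vectors of `(1 - r) I + r Q_δ`. -/
def pertStep (r δ : ℝ) (f : ZMod p → ℝ) : ZMod p → ℝ :=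
  fun x => symStep r f x + r * δ * f 0 * ((if x = 1 then 1 else 0) - if x = -1 then 1 else 0)

/-- One step of the symmetric walk killed at `0`. -/
def killedStep (r : ℝ) (f : ZMod p → ℝ) : ZMod p → ℝ :=
  fun x => if x = 0 then 0 else symStep r f x

lemma symStep_add_neg (r : ℝ) (f : ZMod p → ℝ) (x : ZMod p) :
    symStep r f x + symStep r f (-x) = symStep r (fun y => f y + f (-y)) x := by
  unfold symStep
  rw [show -x + 1 = -(x - 1) by ring, show -x - 1 = -(x + 1) by ring]
  ring

/-- Reflection exchanges `1` and `-1`, so the two perturbation terms cancel. -/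
lemma pertStep_add_neg (r δ : ℝ) (f : ZMod p → ℝ) (x : ZMod p) :
    pertStep r δ f x + pertStep r δ f (-x) = symStep r (fun y => f y + f (-y)) x := by
  rw [← symStep_add_neg]
  unfold pertStep
  simp only [neg_eq_iff_eq_neg]
  ring

/-- A function below `f` that leaves enough room at `0` stays below after one step. -/
lemma symStep_le_pertStep {r δ : ℝ} (h0 : 0 ≤ r) (h1 : r ≤ 1) {f g : ZMod p → ℝ}
    (h : ∀ x, g x ≤ f x) (ha : g 0 ≤ (1 + 2 * δ) * f 0) (hb : g 0 ≤ (1 - 2 * δ) * f 0)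
    (x : ZMod p) : symStep r g x ≤ pertStep r δ f x := by
  have hm := symStep_mono h0 h1 h x
  unfold pertStep
  have hr : 0 ≤ 1 - r := by linarith
  by_cases hx : x = 1 <;> by_cases hx' : x = -1
  · rw [if_pos hx, if_pos hx', sub_self, mul_zero, add_zero]
    exact hm
  · subst hx
    rw [if_pos rfl, if_neg hx']
    have e1 := mul_le_mul_of_nonneg_left (h 1) hr
    have e2 := mul_le_mul_of_nonneg_left (h (1 + 1)) h0
    have e3 := mul_le_mul_of_nonneg_left ha h0
    have e0 : (1 : ZMod p) - 1 = 0 := sub_self 1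
    simp only [symStep, e0]
    ring_nf at e1 e2 e3 ⊢
    linarith
  · subst hx'
    rw [if_pos rfl, if_neg hx]
    have e1 := mul_le_mul_of_nonneg_left (h (-1)) hr
    have e2 := mul_le_mul_of_nonneg_left (h (-1 - 1)) h0
    have e3 := mul_le_mul_of_nonneg_left hb h0
    have e0 : (-1 : ZMod p) + 1 = 0 := neg_add_cancel 1
    simp only [symStep, e0]
    ring_nf at e1 e2 e3 ⊢
    linarith
  · simpa [hx, hx'] using hm

lemma pertStep_nonneg {r δ : ℝ} (h0 : 0 ≤ r) (h1 : r ≤ 1) (hδ : |δ| ≤ 1 / 2) {f : ZMod p → ℝ}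
    (h : ∀ x, 0 ≤ f x) (x : ZMod p) : 0 ≤ pertStep r δ f x := by
  obtain ⟨hl, hu⟩ := abs_le.1 hδ
  have := symStep_le_pertStep h0 h1 (g := fun _ => 0) h
    (mul_nonneg (by linarith) (h 0)) (mul_nonneg (by linarith) (h 0)) x
  simpa [symStep] using this

lemma iterate_killedStep_nonneg {r : ℝ} (h0 : 0 ≤ r) (h1 : r ≤ 1) {f : ZMod p → ℝ}
    (h : ∀ x, 0 ≤ f x) (n : ℕ) (x : ZMod p) : 0 ≤ (killedStep r)^[n] f x := by
  induction n generalizing x with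
  | zero => exact h x
  | succ n ih =>
    rw [Function.iterate_succ_apply']
    unfold killedStep
    split_ifs
    · exact le_rfl
    · exact symStep_nonneg h0 h1 ih x

lemma iterate_killedStep_le {r : ℝ} (h0 : 0 ≤ r) (h1 : r ≤ 1) {f : ZMod p → ℝ}
    (h : ∀ x, 0 ≤ f x) (n : ℕ) (x : ZMod p) : (killedStep r)^[n] f x ≤ (symStep r)^[n] f x := by
  induction n generalizing x with
  | zero => exact le_rfl
  | succ n ih =>
    rw [Function.iterate_succ_apply', Function.iterate_succ_apply']
    have h2 := symStep_mono h0 h1 ih x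
    unfold killedStep
    split_ifs
    · exact symStep_nonneg h0 h1 (iterate_symStep_nonneg h0 h1 h n) x
    · exact h2

lemma iterate_killedStep_zero (r : ℝ) {f : ZMod p → ℝ} (h : f 0 = 0) (n : ℕ) :
    (killedStep r)^[n] f 0 = 0 := by
  cases n with
  | zero => exact h
  | succ n => rw [Function.iterate_succ_apply']; simp [killedStep]

variable [NeZero p]

lemma sum_symStep (r : ℝ) (f : ZMod p → ℝ) : ∑ x, symStep r f x = ∑ x, f x := by
  have h := sum_mul_symStep r (fun _ => 1) f
  have e : symStep r (fun _ : ZMod p => (1 : ℝ)) = fun _ => 1 := by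
    funext x; simp [symStep]
  simpa [e] using h

lemma sum_pertStep (r δ : ℝ) (f : ZMod p → ℝ) : ∑ x, pertStep r δ f x = ∑ x, f x := by
  unfold pertStep
  rw [Finset.sum_add_distrib, sum_symStep, ← Finset.mul_sum, Finset.sum_sub_distrib]
  simp

lemma vecMul_lazy_perturbedWalk (hp : 3 ≤ p) (r δ : ℝ) (f : ZMod p → ℝ) :
    Matrix.vecMul f ((1 - r) • (1 : Matrix (ZMod p) (ZMod p) ℝ) + r • perturbedWalk p δ) =
      pertStep r δ f := by
  -- This is where `3 ≤ p` matters: the two neighbours of a vertex must be distinct.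
  have hne : ∀ x : ZMod p, x + 1 ≠ x - 1 := by
    intro x h
    have h2 : ((2 : ℕ) : ZMod p) = 0 := by
      have : (2 : ZMod p) = (x + 1) - (x - 1) := by ring
      rw [Nat.cast_ofNat, this, h, sub_self]
    rw [ZMod.natCast_eq_zero_iff] at h2
    exact absurd (Nat.le_of_dvd two_pos h2) (by omega)
  have hs : ∀ x y : ZMod p, srw p x y =
      (if x = y - 1 then 1 / 2 else 0) + if x = y + 1 then 1 / 2 else 0 := by
    intro x y
    unfold srw
    by_cases h1 : y = x + 1
    · have h2 : x = y - 1 := by rw [h1]; ring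
      have h3 : x ≠ y + 1 := by
        intro h; exact hne y (h ▸ h2)
      simp [h1]
      intro h
      exact absurd (h.trans (by rw [h1])) h3
    · have h2 : x ≠ y - 1 := by rintro rfl; exact h1 (by ring)
      by_cases h3 : y = x - 1
      · have h4 : x = y + 1 := by rw [h3]; ring
        rw [if_pos (Or.inr h3), if_neg h2, if_pos h4, zero_add]
      · have h4 : x ≠ y + 1 := by rintro rfl; exact h3 (by ring)
        rw [if_neg (by tauto), if_neg h2, if_neg h4, zero_add]
  have hq : ∀ x y : ZMod p, perturbation p δ x y = if x = 0 then
      δ * ((if y = 1 then 1 else 0) - if y = -1 then 1 else 0) else 0 := by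
    intro x y
    unfold perturbation
    have h1 : (1 : ZMod p) ≠ -1 := by simpa using hne 0
    by_cases hx : x = 0
    · by_cases hy : y = 1
      · simp [hx, hy, h1]
      · simp [hx, hy]
        split_ifs <;> simp
    · simp [hx]
  funext y
  rw [Matrix.vecMul_add, Matrix.vecMul_smul, Matrix.vecMul_smul, Matrix.vecMul_one,
    perturbedWalk, Matrix.vecMul_add]
  simp only [Pi.add_apply, Pi.smul_apply, smul_eq_mul, Matrix.vecMul, dotProduct, hs, hq,
    mul_add, mul_ite, mul_zero, Finset.sum_add_distrib, Finset.sum_ite_eq',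
    Finset.mem_univ, if_true, pertStep, symStep]
  ring_nf

/-! ### Decay of the killed walk -/

/-- The supersolution `p² + v (p - v)` of the walk killed at `0`. -/
def hittingWeight (x : ZMod p) : ℝ := (p : ℝ) ^ 2 + x.val * (p - x.val)

lemma hittingWeight_lower (x : ZMod p) : (p : ℝ) ^ 2 ≤ hittingWeight x := by
  have h : (x.val : ℝ) ≤ p := by exact_mod_cast (ZMod.val_lt x).le
  have h0 : (0 : ℝ) ≤ x.val := Nat.cast_nonneg _
  unfold hittingWeight
  nlinarith

lemma hittingWeight_upper (x : ZMod p) : hittingWeight x ≤ 2 * (p : ℝ) ^ 2 := by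
  have h : (x.val : ℝ) ≤ p := by exact_mod_cast (ZMod.val_lt x).le
  have h0 : (0 : ℝ) ≤ x.val := Nat.cast_nonneg _
  unfold hittingWeight
  nlinarith

/-- Averaging `v (p - v)` over both neighbours lowers it by `1`, so a step loses at least `r`, and
`hittingWeight ≤ 2 p²` makes this a relative loss of `r / (2 p²)`. -/
lemma symStep_hittingWeight_le (hp : 2 ≤ p) {r : ℝ} (h0 : 0 ≤ r) {y : ZMod p} (hy : y ≠ 0) :
    symStep r (fun x => if x = 0 then 0 else hittingWeight x) y ≤
      (1 - r / (2 * (p : ℝ) ^ 2)) * hittingWeight y := by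
  have hp' : (2 : ℝ) ≤ p := by exact_mod_cast hp
  have hval1 : (1 : ZMod p).val = 1 := ZMod.val_one'' (by omega)
  -- The parameter `t` lets the neighbour `0` of `p - 1` be read as `t = p`, where the parabola
  -- still dominates the value `0`.
  have hle : ∀ (z : ZMod p) (t : ℝ), ((z.val : ℝ) = t ∨ z = 0) → 0 ≤ t → t ≤ p →
      (if z = 0 then 0 else hittingWeight z) ≤ (p : ℝ) ^ 2 + t * (p - t) := by
    intro z t h ht ht'
    split_ifs with hz
    · nlinarith
    · rcases h with h | h
      · rw [hittingWeight, h]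
      · exact absurd h hz
  have hlt := ZMod.val_lt y
  have hpos : 1 ≤ y.val := Nat.one_le_iff_ne_zero.2 (by rwa [Ne, ZMod.val_eq_zero])
  have hlt' : (y.val : ℝ) + 1 ≤ p := by exact_mod_cast hlt
  have hpos' : (1 : ℝ) ≤ y.val := by exact_mod_cast hpos
  have hA := hle (y + 1) (y.val + 1) (by
    rcases Nat.lt_or_ge (y.val + 1) p with h | h
    · left
      rw [ZMod.val_add, hval1, Nat.mod_eq_of_lt h]
      push_cast; rfl
    · right
      rw [← ZMod.val_eq_zero, ZMod.val_add, hval1, show y.val + 1 = p by omega, Nat.mod_self])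
    (by linarith) hlt'
  have hB := hle (y - 1) (y.val - 1) (by
    left
    rw [ZMod.val_sub (by rw [hval1]; exact hpos), hval1, Nat.cast_sub hpos, Nat.cast_one])
    (by linarith) (by linarith)
  have hU := hittingWeight_upper y
  have hfrac : r / (2 * (p : ℝ) ^ 2) * hittingWeight y ≤ r := by
    rw [div_mul_eq_mul_div, div_le_iff₀ (by positivity)]
    gcongr
  simp only [symStep, if_neg hy]
  have hC := mul_le_mul_of_nonneg_left (add_le_add hA hB) h0
  have hW : hittingWeight y = (p : ℝ) ^ 2 + y.val * (p - y.val) := rfl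
  rw [one_sub_mul]
  nlinarith

/-- By self-adjointness of `symStep`, the weighted mass contracts at each step. The factor `2` is
the ratio of the bounds on the weight. -/
lemma sum_iterate_killedStep_le (hp : 2 ≤ p) {r : ℝ} (h0 : 0 ≤ r) (h1 : r ≤ 1)
    {f : ZMod p → ℝ} (hf : ∀ x, 0 ≤ f x) (hf0 : f 0 = 0) (n : ℕ) :
    ∑ x, (killedStep r)^[n] f x ≤ 2 * (1 - r / (2 * (p : ℝ) ^ 2)) ^ n * ∑ x, f x := by
  have hp' : (2 : ℝ) ≤ p := by exact_mod_cast hp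
  have hρ : 0 ≤ 1 - r / (2 * (p : ℝ) ^ 2) := by
    rw [sub_nonneg, div_le_one (by positivity)]
    nlinarith
  have key : ∑ x, (killedStep r)^[n] f x * hittingWeight x ≤
      (1 - r / (2 * (p : ℝ) ^ 2)) ^ n * ∑ x, f x * hittingWeight x := by
    induction n with
    | zero => simp
    | succ n ih =>
      rw [pow_succ', mul_assoc]
      refine le_trans ?_ (mul_le_mul_of_nonneg_left ih hρ)
      rw [Function.iterate_succ_apply', Finset.mul_sum]
      set b := (killedStep r)^[n] f with hb
      have hb0 : b 0 = 0 := iterate_killedStep_zero r hf0 n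
      have hbn : ∀ x, 0 ≤ b x := iterate_killedStep_nonneg h0 h1 hf n
      have e : ∑ x, killedStep r b x * hittingWeight x =
          ∑ x, symStep r b x * (if x = 0 then 0 else hittingWeight x) := by
        refine Finset.sum_congr rfl fun x _ => ?_
        unfold killedStep
        split_ifs <;> simp
      rw [e, ← sum_mul_symStep]
      refine Finset.sum_le_sum fun x _ => ?_
      by_cases hx : x = 0
      · rw [hx, hb0]; simp
      · have := mul_le_mul_of_nonneg_left (symStep_hittingWeight_le hp h0 hx) (hbn x)
        linarith
  have hl : (p : ℝ) ^ 2 * ∑ x, (killedStep r)^[n] f x ≤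
      ∑ x, (killedStep r)^[n] f x * hittingWeight x := by
    rw [Finset.mul_sum]
    refine Finset.sum_le_sum fun x _ => ?_
    rw [mul_comm]
    exact mul_le_mul_of_nonneg_left (hittingWeight_lower x)
      (iterate_killedStep_nonneg h0 h1 hf n x)
  have hu : ∑ x, f x * hittingWeight x ≤ 2 * (p : ℝ) ^ 2 * ∑ x, f x := by
    rw [Finset.mul_sum]
    refine Finset.sum_le_sum fun x _ => ?_
    rw [mul_comm (2 * (p : ℝ) ^ 2)]
    exact mul_le_mul_of_nonneg_left (hittingWeight_upper x) (hf x)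
  have hp2 : (0 : ℝ) < (p : ℝ) ^ 2 := by positivity
  refine le_of_mul_le_mul_left ?_ hp2
  calc _ ≤ _ := hl
    _ ≤ _ := key
    _ ≤ _ := mul_le_mul_of_nonneg_left hu (pow_nonneg hρ n)
    _ = _ := by ring

end PerturbedStep

/-! ### Two-sided bounds on the perturbed heat kernel -/

section HeatKernel

variable {p : ℕ} {r ε : ℝ} {δ : ℕ → ℝ} {ν : ℕ → ZMod p → ℝ}

lemma orbit_add_neg (hstep : ∀ n, ν (n + 1) = pertStep r (δ (n + 1)) (ν n)) (n : ℕ)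
    (x : ZMod p) : ν n x + ν n (-x) = (symStep r)^[n] (fun y => ν 0 y + ν 0 (-y)) x := by
  induction n generalizing x with
  | zero => rfl
  | succ n ih =>
    rw [Function.iterate_succ_apply', hstep, pertStep_add_neg]
    congr 1
    funext y
    exact ih y

lemma orbit_nonneg (hr0 : 0 ≤ r) (hr1 : r ≤ 1) (hε' : ε ≤ 1 / 2)
    (hδ : ∀ i, 1 ≤ i → |δ i| ≤ ε) (h0 : ∀ x, 0 ≤ ν 0 x)
    (hstep : ∀ n, ν (n + 1) = pertStep r (δ (n + 1)) (ν n)) (n : ℕ) (x : ZMod p) :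
    0 ≤ ν n x := by
  induction n generalizing x with
  | zero => exact h0 x
  | succ n ih =>
    rw [hstep]
    exact pertStep_nonneg hr0 hr1 ((hδ _ (by omega)).trans hε') ih x

/-- Mass that has visited `0` is spread on both sides of `0` up to the factor `1 / 2 - ε`. -/
lemma le_orbit (hr0 : 0 ≤ r) (hr1 : r ≤ 1) (hε : 0 ≤ ε) (hε' : ε ≤ 1 / 2)
    (hδ : ∀ i, 1 ≤ i → |δ i| ≤ ε) (h0 : ∀ x, 0 ≤ ν 0 x)
    (hstep : ∀ n, ν (n + 1) = pertStep r (δ (n + 1)) (ν n)) (n : ℕ) (x : ZMod p) :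
    (1 / 2 - ε) * ((symStep r)^[n] (fun y => ν 0 y + ν 0 (-y)) x -
      (killedStep r)^[n] (fun y => if y = 0 then 0 else ν 0 y + ν 0 (-y)) x) ≤ ν n x := by
  set e : ℕ → ZMod p → ℝ := fun n => (symStep r)^[n] (fun y => ν 0 y + ν 0 (-y)) with he
  set b : ℕ → ZMod p → ℝ :=
    fun n => (killedStep r)^[n] (fun y => if y = 0 then 0 else ν 0 y + ν 0 (-y)) with hb
  have hb0 : ∀ n, b n 0 = 0 := fun n => iterate_killedStep_zero r (by simp) n
  have hnn := orbit_nonneg hr0 hr1 hε' hδ h0 hstep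
  have hzero : ∀ n, e n 0 = 2 * ν n 0 := by
    intro n
    have := orbit_add_neg hstep n 0
    rw [neg_zero] at this
    change (symStep r)^[n] _ 0 = _
    rw [← this]; ring
  change (1 / 2 - ε) * (e n x - b n x) ≤ ν n x
  induction n generalizing x with
  | zero =>
    change (1 / 2 - ε) * (ν 0 x + ν 0 (-x) - if x = 0 then 0 else ν 0 x + ν 0 (-x)) ≤ ν 0 x
    split_ifs with hx
    · rw [hx, neg_zero]
      nlinarith [h0 0]
    · simpa using h0 x
  | succ n ih =>
    by_cases hx : x = 0
    · rw [hx, hb0, hzero]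
      nlinarith [hnn (n + 1) 0]
    · obtain ⟨hl, hu⟩ := abs_le.1 (hδ (n + 1) (by omega))
      have hz := hnn n 0
      -- At `0` the lower bound equals `(1 - 2 ε) ν n 0`, hence is at most `(1 ± 2 δ) ν n 0`.
      have := symStep_le_pertStep (δ := δ (n + 1)) hr0 hr1 ih
        (by rw [hb0, hzero]; nlinarith) (by rw [hb0, hzero]; nlinarith) x
      rw [hstep]
      refine le_trans (le_of_eq ?_) this
      have e1 : e (n + 1) = symStep r (e n) := Function.iterate_succ_apply' _ _ _
      have e2 : b (n + 1) = killedStep r (b n) := Function.iterate_succ_apply' _ _ _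
      rw [e1, e2, killedStep, if_neg hx]
      unfold symStep
      ring

variable [NeZero p]

lemma iterate_symStep_bounds {r : ℝ}
    {f : ZMod p → ℝ} (hf : ∀ x, 0 ≤ f x) {n : ℕ}
    (hs : ∑ k ∈ Finset.univ.erase (0 : ZMod p), |symEigenvalue r k| ^ n ≤ 1 / 2) (x : ZMod p) :
    1 / 2 * ((∑ y, f y) / p) ≤ (symStep r)^[n] f x ∧
      (symStep r)^[n] f x ≤ 3 / 2 * ((∑ y, f y) / p) := by
  have h := abs_iterate_symStep_sub_le r hf n x
  have hF : 0 ≤ (∑ y, f y) / (p : ℝ) :=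
    div_nonneg (Finset.sum_nonneg fun y _ => hf y) (Nat.cast_nonneg _)
  have h2 := h.trans (mul_le_mul_of_nonneg_left hs hF)
  rw [abs_le] at h2
  constructor <;> linarith [h2.1, h2.2]

lemma one_sub_div_pow_le {r : ℝ} (hr : 1 / 2 ≤ r) (hr1 : r ≤ 1) {n : ℕ} (hn : 16 * p ^ 2 ≤ n) :
    (1 - r / (2 * (p : ℝ) ^ 2)) ^ n ≤ 1 / 10 := by
  have hp : (1 : ℝ) ≤ p := by exact_mod_cast NeZero.one_le
  have hn' : 16 * (p : ℝ) ^ 2 ≤ n := by exact_mod_cast hn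
  have h0 : 0 ≤ 1 - r / (2 * (p : ℝ) ^ 2) := by
    rw [sub_nonneg, div_le_one (by positivity)]
    nlinarith
  have h4 : Real.exp (-4) ≤ 1 / 10 := by
    rw [Real.exp_neg, one_div]
    have h1 : (2 : ℝ) ≤ Real.exp 1 := by linarith [Real.add_one_le_exp (1 : ℝ)]
    have h2 : Real.exp 4 = Real.exp 1 ^ 4 := by rw [← Real.exp_nat_mul]; norm_num
    rw [h2]
    gcongr
    calc (10 : ℝ) ≤ 2 ^ 4 := by norm_num
      _ ≤ _ := by gcongr
  calc _ ≤ Real.exp (-(r / (2 * (p : ℝ) ^ 2))) ^ n := by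
        gcongr
        linarith [Real.add_one_le_exp (-(r / (2 * (p : ℝ) ^ 2)))]
    _ = Real.exp (-(n * (r / (2 * (p : ℝ) ^ 2)))) := by rw [← Real.exp_nat_mul]; ring_nf
    -- The exponent is at least `16 p² · (1 / 2) / (2 p²) = 4`.
    _ ≤ Real.exp (-4) := by
        apply Real.exp_le_exp.2
        rw [neg_le_neg_iff, mul_div_assoc', le_div_iff₀ (by positivity)]
        nlinarith
    _ ≤ _ := h4

/-- Two-sided heat kernel bounds for the perturbed walk after order `p²` steps. -/
lemma orbit_bounds (hp : 2 ≤ p) (hr : 1 / 2 ≤ r) (hr1 : r ≤ 1)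
    (hs : ∀ n, 16 * p ^ 2 ≤ n →
      ∑ k ∈ Finset.univ.erase (0 : ZMod p), |symEigenvalue r k| ^ n ≤ 1 / 2)
    (hε : 0 ≤ ε) (hε' : ε ≤ 1 / 2) (hδ : ∀ i, 1 ≤ i → |δ i| ≤ ε)
    (h0 : ∀ x, 0 ≤ ν 0 x) (hsum : ∑ x, ν 0 x = 1)
    (hstep : ∀ n, ν (n + 1) = pertStep r (δ (n + 1)) (ν n)) {n : ℕ} (hn : 32 * p ^ 2 ≤ n)
    (x : ZMod p) : (1 / 2 - ε) / 5 / p ≤ ν n x ∧ ν n x ≤ 3 / p := by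
  have hr0 : 0 ≤ r := by linarith
  have hp0 : (0 : ℝ) < p := by exact_mod_cast NeZero.pos p
  set e₀ : ZMod p → ℝ := fun y => ν 0 y + ν 0 (-y) with he
  set b₀ : ZMod p → ℝ := fun y => if y = 0 then 0 else ν 0 y + ν 0 (-y) with hb
  have hnn := orbit_nonneg hr0 hr1 hε' hδ h0 hstep
  have he0 : ∀ y, 0 ≤ e₀ y := fun y => add_nonneg (h0 _) (h0 _)
  have hb0 : ∀ y, 0 ≤ b₀ y := fun y => by
    simp only [hb]; split_ifs
    exacts [le_rfl, he0 y]
  have hesum : ∑ y, e₀ y = 2 := by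
    rw [Finset.sum_add_distrib, hsum,
      Fintype.sum_equiv (Equiv.neg (ZMod p)) (fun y => ν 0 (-y)) (ν 0) (by simp), hsum]
    norm_num
  have hbsum : ∑ y, b₀ y ≤ 2 := by
    rw [← hesum]
    refine Finset.sum_le_sum fun y _ => ?_
    simp only [hb]; split_ifs
    exacts [he0 y, le_rfl]
  obtain ⟨hel, heu⟩ := iterate_symStep_bounds he0 (hs n (by omega)) x
  rw [hesum] at hel heu
  have hbu : (killedStep r)^[n] b₀ x ≤ 3 / 5 / p := by
    -- The first `m` steps reduce the killed mass to at most `2 / 5`; the last `16 p²` steps spread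
    -- it to height `(3 / 2) (2 / 5) / p`.
    obtain ⟨m, rfl⟩ := Nat.exists_eq_add_of_le (show 16 * p ^ 2 ≤ n by omega)
    have hm : 16 * p ^ 2 ≤ m := by omega
    have hbn := iterate_killedStep_nonneg hr0 hr1 hb0 m
    rw [Function.iterate_add_apply]
    refine (iterate_killedStep_le hr0 hr1 hbn _ x).trans ?_
    refine (iterate_symStep_bounds hbn (hs _ le_rfl) x).2.trans ?_
    have h1 := sum_iterate_killedStep_le hp hr0 hr1 hb0 (by simp [hb]) m
    have h2 : ∑ y, (killedStep r)^[m] b₀ y ≤ 2 * (1 / 10) * 2 := by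
      refine h1.trans ?_
      have := one_sub_div_pow_le (p := p) hr hr1 hm
      gcongr
      exact Finset.sum_nonneg fun y _ => hb0 y
    calc _ ≤ 3 / 2 * (2 * (1 / 10) * 2 / (p : ℝ)) := by gcongr
      _ = _ := by ring
  constructor
  · refine le_trans ?_ (le_orbit hr0 hr1 hε hε' hδ h0 hstep n x)
    have h2 : 2 / 5 / (p : ℝ) ≤ (symStep r)^[n] e₀ x - (killedStep r)^[n] b₀ x := by
      refine le_trans (le_of_eq ?_) (sub_le_sub hel hbu)
      field_simp
      norm_num
    calc (1 / 2 - ε) / 5 / p ≤ (1 / 2 - ε) * (2 / 5 / p) := by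
          have : 0 ≤ (1 / 2 - ε) / 5 / p :=
            div_nonneg (div_nonneg (by linarith) (by norm_num)) hp0.le
          rw [show (1 / 2 - ε) * (2 / 5 / (p : ℝ)) = 2 * ((1 / 2 - ε) / 5 / p) by ring]
          linarith
      _ ≤ _ := mul_le_mul_of_nonneg_left h2 (by linarith)
  · have h1 := orbit_add_neg hstep n x
    have h2 := hnn n (-x)
    calc ν n x ≤ (symStep r)^[n] e₀ x := by rw [← h1]; linarith
      _ ≤ _ := heu
      _ = _ := by ring

end HeatKernel

/-! ### Contraction from two-sided block bounds -/

section Doeblin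

variable {V : Type*} [Fintype V]

lemma sum_mul_apply_sub (A B P : Matrix V V ℝ) (x y z : V) :
    (A * P) x z - (B * P) y z = ∑ w, (A x w - B y w) * P w z := by
  simp only [Matrix.mul_apply, ← Finset.sum_sub_distrib, sub_mul]

/-- Doeblin's contraction: a kernel with entries at least `u` contracts differences of probability
vectors by the factor `1 - |V| u`. -/
lemma sum_abs_sum_mul_le {a : V → ℝ} (ha : ∑ w, a w = 0) {P : Matrix V V ℝ} {u : ℝ}
    (hP : ∀ x, ∑ z, P x z = 1) (hu : ∀ x z, u ≤ P x z) :
    ∑ z, |∑ w, a w * P w z| ≤ (1 - Fintype.card V * u) * ∑ w, |a w| := by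
  have h : ∀ z, |∑ w, a w * P w z| ≤ ∑ w, |a w| * (P w z - u) := by
    intro z
    -- Since `a` has total mass `0`, the common part `u` of the rows can be subtracted.
    have e : ∑ w, a w * P w z = ∑ w, a w * (P w z - u) := by
      simp_rw [mul_sub, Finset.sum_sub_distrib, ← Finset.sum_mul, ha, zero_mul, sub_zero]
    rw [e]
    refine (Finset.abs_sum_le_sum_abs _ _).trans (le_of_eq ?_)
    refine Finset.sum_congr rfl fun w _ => ?_
    rw [abs_mul, abs_of_nonneg (sub_nonneg.2 (hu w z))]
  refine (Finset.sum_le_sum fun z _ => h z).trans (le_of_eq ?_)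
  rw [Finset.sum_comm, Finset.mul_sum]
  refine Finset.sum_congr rfl fun w _ => ?_
  rw [← Finset.mul_sum, Finset.sum_sub_distrib, hP, Finset.sum_const, Finset.card_univ,
    nsmul_eq_mul, mul_comm]

lemma tvDist_le_sum_abs (μ ν : V → ℝ) : tvDist μ ν ≤ ∑ z, |μ z - ν z| := by
  refine ciSup_le fun A => ?_
  rw [← Finset.sum_sub_distrib]
  calc _ ≤ ∑ z ∈ A, |μ z - ν z| := Finset.sum_le_sum fun z _ => le_abs_self _
    _ ≤ _ := Finset.sum_le_sum_of_subset_of_nonneg (Finset.subset_univ _)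
        fun z _ _ => abs_nonneg _

variable [DecidableEq V]

lemma stepProd_add (K : ℕ → Matrix V V ℝ) (m n : ℕ) :
    stepProd K (m + n) = stepProd K m * stepProd (fun i => K (m + i)) n := by
  induction n with
  | zero => simp [stepProd]
  | succ n ih => rw [← add_assoc, stepProd, ih, stepProd, mul_assoc, add_assoc]

lemma stepProd_succ_apply (K : ℕ → Matrix V V ℝ) (n : ℕ) (x : V) :
    stepProd K (n + 1) x = Matrix.vecMul (stepProd K n x) (K (n + 1)) := by
  rw [stepProd]; rfl

variable {𝒬 : Set (Matrix V V ℝ)} {u U : ℝ} {T : ℕ}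

/-- Induction on blocks. The hypotheses range over all sequences in `𝒬` because each later block
belongs to a shifted sequence. -/
lemma sum_abs_stepProd_sub_le
    (hnn : ∀ K : ℕ → Matrix V V ℝ, (∀ i, 1 ≤ i → K i ∈ 𝒬) → ∀ n x z, 0 ≤ stepProd K n x z)
    (hrow : ∀ K : ℕ → Matrix V V ℝ, (∀ i, 1 ≤ i → K i ∈ 𝒬) → ∀ n x, ∑ z, stepProd K n x z = 1)
    (hu : ∀ K : ℕ → Matrix V V ℝ, (∀ i, 1 ≤ i → K i ∈ 𝒬) → ∀ x z, u ≤ stepProd K T x z)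
    (hu1 : Fintype.card V * u ≤ 1) {K : ℕ → Matrix V V ℝ} (hK : ∀ i, 1 ≤ i → K i ∈ 𝒬)
    (j k : ℕ) (x y : V) :
    ∑ z, |stepProd K (j + k * T) x z - stepProd K (j + k * T) y z| ≤
      2 * (1 - Fintype.card V * u) ^ k := by
  induction k with
  | zero =>
    calc _ ≤ ∑ z, (stepProd K (j + 0 * T) x z + stepProd K (j + 0 * T) y z) := by
          refine Finset.sum_le_sum fun z _ => ?_
          have h1 := hnn K hK (j + 0 * T) x z
          have h2 := hnn K hK (j + 0 * T) y z
          rw [abs_le]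
          constructor <;> linarith
      _ ≤ _ := by
          rw [Finset.sum_add_distrib, hrow K hK, hrow K hK]
          norm_num
  | succ k ih =>
    have hK' : ∀ i, 1 ≤ i → K (j + k * T + i) ∈ 𝒬 := fun i hi => hK _ (by omega)
    rw [add_mul, one_mul, ← add_assoc, stepProd_add K (j + k * T) T]
    simp_rw [sum_mul_apply_sub]
    refine (sum_abs_sum_mul_le ?_ (hrow _ hK' T) (hu _ hK')).trans ?_
    · rw [Finset.sum_sub_distrib, hrow K hK, hrow K hK, sub_self]
    · calc _ ≤ (1 - Fintype.card V * u) * (2 * (1 - Fintype.card V * u) ^ k) :=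
            mul_le_mul_of_nonneg_left ih (by linarith)
        _ = _ := by ring

/-- Two-sided bounds on blocks of length `T` imply merging at an exponential rate. -/
theorem maxTV_le_and_maxRelDev_le [Nonempty V]
    (hnn : ∀ K : ℕ → Matrix V V ℝ, (∀ i, 1 ≤ i → K i ∈ 𝒬) → ∀ n x z, 0 ≤ stepProd K n x z)
    (hrow : ∀ K : ℕ → Matrix V V ℝ, (∀ i, 1 ≤ i → K i ∈ 𝒬) → ∀ n x, ∑ z, stepProd K n x z = 1)
    (hu : ∀ K : ℕ → Matrix V V ℝ, (∀ i, 1 ≤ i → K i ∈ 𝒬) → ∀ x z, u ≤ stepProd K T x z)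
    (hU : ∀ K : ℕ → Matrix V V ℝ, (∀ i, 1 ≤ i → K i ∈ 𝒬) → ∀ x z, stepProd K T x z ≤ U)
    (hu0 : 0 < u) {K : ℕ → Matrix V V ℝ} (hK : ∀ i, 1 ≤ i → K i ∈ 𝒬)
    {n k : ℕ} (hn : (k + 1) * T ≤ n) :
    maxTV K n ≤ 2 * (1 - Fintype.card V * u) ^ k ∧
      maxRelDev K n ≤ ENNReal.ofReal (2 * (U / u) * (1 - Fintype.card V * u) ^ k) := by
  have hu1 : Fintype.card V * u ≤ 1 := by
    obtain ⟨x⟩ := ‹Nonempty V›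
    rw [← hrow K hK T x, ← nsmul_eq_mul, ← Finset.card_univ]
    exact Finset.card_nsmul_le_sum _ _ _ fun z _ => hu K hK x z
  constructor
  · obtain ⟨j, rfl⟩ := Nat.exists_eq_add_of_le (show k * T ≤ n by nlinarith)
    rw [add_comm]
    exact ciSup_le fun x => ciSup_le fun y => (tvDist_le_sum_abs _ _).trans
      (sum_abs_stepProd_sub_le hnn hrow hu hu1 hK j k x y)
  · obtain ⟨j, rfl⟩ := Nat.exists_eq_add_of_le hn
    -- The first `j + k * T` steps contract the `ℓ¹` distance; the last block, through `u` and `U`,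
    -- converts it into a pointwise relative bound.
    have e : (k + 1) * T + j = (j + k * T) + T := by ring
    rw [e]
    have hK' : ∀ i, 1 ≤ i → K (j + k * T + i) ∈ 𝒬 := fun i hi => hK _ (by omega)
    refine iSup_le fun x => iSup_le fun y => iSup_le fun z => ?_
    have hl : u ≤ stepProd K (j + k * T + T) y z := by
      rw [stepProd_add, Matrix.mul_apply]
      calc u = ∑ w, stepProd K (j + k * T) y w * u := by
            rw [← Finset.sum_mul, hrow K hK, one_mul]
        _ ≤ _ := Finset.sum_le_sum fun w _ =>
            mul_le_mul_of_nonneg_left (hu _ hK' w z) (hnn K hK _ y w)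
    have hd : |stepProd K (j + k * T + T) x z - stepProd K (j + k * T + T) y z| ≤
        2 * (1 - Fintype.card V * u) ^ k * U := by
      rw [stepProd_add, sum_mul_apply_sub]
      have hU0 : 0 ≤ U := hu0.le.trans ((hu K hK x z).trans (hU K hK x z))
      calc _ ≤ ∑ w, |stepProd K (j + k * T) x w - stepProd K (j + k * T) y w| * U := by
            refine (Finset.abs_sum_le_sum_abs _ _).trans (Finset.sum_le_sum fun w _ => ?_)
            rw [abs_mul, abs_of_nonneg (hnn _ hK' T w z)]
            exact mul_le_mul_of_nonneg_left (hU _ hK' w z) (abs_nonneg _)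
        _ ≤ _ := by
            rw [← Finset.sum_mul]
            exact mul_le_mul_of_nonneg_right
              (sum_abs_stepProd_sub_le hnn hrow hu hu1 hK j k x y) hU0
    have hb : 0 < stepProd K (j + k * T + T) y z := hu0.trans_le hl
    rw [relDev, if_neg hb.ne']
    apply ENNReal.ofReal_le_ofReal
    rw [div_sub_one hb.ne', abs_div, abs_of_pos hb]
    calc _ ≤ 2 * (1 - Fintype.card V * u) ^ k * U / u :=
          div_le_div₀ ((abs_nonneg _).trans hd) hd hu0 hl
      _ = _ := by ring

end Doeblin

/-! ### Conclusion -/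

/-- The block length is `288 N² = 32 (3 N)²`, used with `p ≤ 3 N`. The condition `< n + 1` also
admits `n = ⌊timeBound B N η⌋₊`, needed for the merging time. -/
lemma exists_blocks {c : ℝ} (hc : 0 < c) (hc1 : c ≤ 1) :
    ∃ B : ℝ, 0 < B ∧ ∀ N : ℕ, 1 ≤ N → ∀ η : ℝ, 0 < η → ∀ n : ℕ, timeBound B N η < n + 1 →
      ∃ k : ℕ, (k + 1) * (288 * N ^ 2) ≤ n ∧ 12 / c * (1 - c) ^ k ≤ η := by
  have hG : 1 ≤ 12 / c := by rw [le_div_iff₀ hc]; linarith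
  have hlog : 0 ≤ Real.log (12 / c) := Real.log_nonneg hG
  have hX : 0 ≤ (Real.log (12 / c) + 1) / c := by positivity
  -- The `4` absorbs the rounding, the extra block and the shift from `n` to `n + 1`; the other term
  -- makes `(1 - c) ^ k` beat both `12 / c` and `1 / η`.
  refine ⟨288 * (4 + (Real.log (12 / c) + 1) / c), by positivity, fun N hN η hη n hn => ?_⟩
  set X := (Real.log (12 / c) + 1) / c with hXdef
  have hL : 0 ≤ Real.posLog (1 / η) := Real.posLog_nonneg
  have hL' : Real.log (1 / η) ≤ Real.posLog (1 / η) := le_max_right _ _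
  set L := Real.posLog (1 / η) with hLdef
  have hN' : (1 : ℝ) ≤ N := by exact_mod_cast hN
  have hT : (1 : ℝ) ≤ 288 * (N : ℝ) ^ 2 := by nlinarith
  have hn1 : ((4 + X) * (1 + L) - 1) * (288 * (N : ℝ) ^ 2) < n := by
    have : timeBound (288 * (4 + X)) N η = (4 + X) * (1 + L) * (288 * (N : ℝ) ^ 2) := by
      rw [timeBound, ← hLdef]; ring
    rw [this] at hn
    linarith
  have hTpos : 0 < 288 * N ^ 2 := by positivity
  have hdm := Nat.lt_div_mul_add (a := n) hTpos
  have hge : 1 ≤ n / (288 * N ^ 2) := by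
    rw [Nat.one_le_div_iff hTpos]
    have : (288 * (N : ℝ) ^ 2) ≤ n := by
      refine le_trans ?_ hn1.le
      nlinarith [mul_nonneg hX hL]
    exact_mod_cast this
  refine ⟨n / (288 * N ^ 2) - 1, ?_, ?_⟩
  · rw [Nat.sub_add_cancel hge]
    exact Nat.div_mul_le_self _ _
  · obtain ⟨k, hk⟩ := Nat.exists_eq_add_of_le hge
    rw [hk, Nat.add_sub_cancel_left]
    rw [hk] at hdm
    have hdm' : (n : ℝ) < (k + 2) * (288 * (N : ℝ) ^ 2) := by
      have : n < (k + 2) * (288 * N ^ 2) := by linarith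
      exact_mod_cast this
    have hkX : X * (1 + L) ≤ k := by
      have h1 := lt_of_mul_lt_mul_right (hn1.trans hdm') (by linarith)
      nlinarith
    have hck : Real.log (12 / c) + L ≤ c * k := by
      have h1 := mul_le_mul_of_nonneg_left hkX hc.le
      have h2 : c * (X * (1 + L)) = (Real.log (12 / c) + 1) * (1 + L) := by
        rw [hXdef]; field_simp
      nlinarith [mul_nonneg hlog hL]
    have hη' : Real.exp (-L) ≤ η := by
      rw [one_div, Real.log_inv] at hL'
      calc Real.exp (-L) ≤ Real.exp (Real.log η) := Real.exp_le_exp.2 (by linarith)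
        _ = η := Real.exp_log hη
    calc 12 / c * (1 - c) ^ k ≤ 12 / c * Real.exp (-c) ^ k := by
          have : 0 ≤ 1 - c := by linarith
          gcongr
          linarith [Real.add_one_le_exp (-c)]
      _ = 12 / c * Real.exp (-(c * k)) := by rw [← Real.exp_nat_mul]; ring_nf
      _ ≤ 12 / c * Real.exp (-Real.log (12 / c) + -L) := by
          gcongr; linarith
      _ = Real.exp (-L) := by
          rw [Real.exp_add, Real.exp_neg (Real.log _), Real.exp_log (by positivity)]
          field_simp
      _ ≤ η := hη'

/-! ### The lazy and non-lazy families as one family with parameter `r` -/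

section Families

variable {p : ℕ}

/-- The kernels `(1 - r) I + r Q_δ` with `|δ| ≤ ε`. -/
def holdingFamily (p : ℕ) (r ε : ℝ) : Set (Matrix (ZMod p) (ZMod p) ℝ) :=
  {K | ∃ δ : ℝ, |δ| ≤ ε ∧ K = (1 - r) • 1 + r • perturbedWalk p δ}

lemma family_eq (ε : ℝ) : family p ε = holdingFamily p 1 ε := by
  ext K
  simp [family, holdingFamily, abs_le]

lemma lazyFamily_eq (ε : ℝ) : lazyFamily p ε = holdingFamily p (1 / 2) ε := by
  have h : (1 - 1 / 2 : ℝ) = 1 / 2 := by norm_num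
  ext K
  simp only [lazyFamily, family, holdingFamily, abs_le, Set.mem_ofPred_eq, Set.mem_Icc, h,
    smul_add]
  constructor
  · rintro ⟨_, ⟨δ, hδ, rfl⟩, rfl⟩
    exact ⟨δ, hδ, rfl⟩
  · rintro ⟨δ, hδ, rfl⟩
    exact ⟨_, ⟨δ, hδ, rfl⟩, rfl⟩

variable [NeZero p] {r ε : ℝ}

lemma holdingFamily_stepProd_bounds (hp : 3 ≤ p) (hr : 1 / 2 ≤ r) (hr1 : r ≤ 1)
    (hs : ∀ n, 16 * p ^ 2 ≤ n →
      ∑ k ∈ Finset.univ.erase (0 : ZMod p), |symEigenvalue r k| ^ n ≤ 1 / 2)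
    (hε : 0 ≤ ε) (hε' : ε ≤ 1 / 2) {K : ℕ → Matrix (ZMod p) (ZMod p) ℝ}
    (hK : ∀ i, 1 ≤ i → K i ∈ holdingFamily p r ε) (x : ZMod p) :
    (∀ n z, 0 ≤ stepProd K n x z) ∧ (∀ n, ∑ z, stepProd K n x z = 1) ∧
      ∀ n, 32 * p ^ 2 ≤ n → ∀ z, (1 / 2 - ε) / 5 / p ≤ stepProd K n x z ∧
        stepProd K n x z ≤ 3 / p := by
  -- `K 0` is unconstrained, so index `0` gets a dummy `δ`.
  have hex : ∀ i, ∃ δ : ℝ, 1 ≤ i → |δ| ≤ ε ∧ K i = (1 - r) • 1 + r • perturbedWalk p δ := by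
    intro i
    by_cases hi : 1 ≤ i
    · obtain ⟨δ, h⟩ := hK i hi
      exact ⟨δ, fun _ => h⟩
    · exact ⟨0, fun h => absurd h hi⟩
  choose δ hδ using hex
  have hstep : ∀ n, stepProd K (n + 1) x = pertStep r (δ (n + 1)) (stepProd K n x) := by
    intro n
    rw [stepProd_succ_apply, (hδ (n + 1) (by omega)).2, vecMul_lazy_perturbedWalk hp]
  have hδ' : ∀ i, 1 ≤ i → |δ i| ≤ ε := fun i hi => (hδ i hi).1
  have h0 : ∀ z, 0 ≤ stepProd K 0 x z := by
    intro z
    simp only [stepProd, Matrix.one_apply]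
    split_ifs <;> norm_num
  have hsum : ∑ z, stepProd K 0 x z = 1 := by
    simp [stepProd, Matrix.one_apply]
  refine ⟨orbit_nonneg (by linarith) hr1 hε' hδ' h0 hstep, fun n => ?_, fun n hn z =>
    orbit_bounds (ν := fun n => stepProd K n x) (by omega) hr hr1 hs hε hε' hδ' h0 hsum hstep hn z⟩
  induction n with
  | zero => exact hsum
  | succ n ih => rw [hstep, sum_pertStep, ih]

/-- With `u = c / p` the Doeblin factor is `1 - c`, free of `p`, so the size of the circle enters
only through the block length. -/
lemma holdingFamily_merging (hp : 3 ≤ p) (hr : 1 / 2 ≤ r) (hr1 : r ≤ 1)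
    (hs : ∀ n, 16 * p ^ 2 ≤ n →
      ∑ k ∈ Finset.univ.erase (0 : ZMod p), |symEigenvalue r k| ^ n ≤ 1 / 2)
    (hε : 0 ≤ ε) (hε' : ε < 1 / 2) {N : ℕ} (hN : p ≤ 3 * N) {B η : ℝ} (hB : 0 < B) (hη : 0 < η)
    (hblocks : ∀ n : ℕ, timeBound B N η < n + 1 → ∃ k : ℕ, (k + 1) * (288 * N ^ 2) ≤ n ∧
      12 / ((1 / 2 - ε) / 5) * (1 - (1 / 2 - ε) / 5) ^ k ≤ η) :
    HasTVMergingTimeAtMost (holdingFamily p r ε) η (timeBound B N η) ∧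
      ∀ K : ℕ → Matrix (ZMod p) (ZMod p) ℝ, (∀ i, 1 ≤ i → K i ∈ holdingFamily p r ε) →
        ∀ n : ℕ, timeBound B N η ≤ (n : ℝ) → maxRelDev K n ≤ ENNReal.ofReal η := by
  have hp0 : (0 : ℝ) < p := by exact_mod_cast NeZero.pos p
  set c : ℝ := (1 / 2 - ε) / 5 with hc
  have hc0 : 0 < c := by rw [hc]; linarith
  have hc1 : c ≤ 1 := by rw [hc]; linarith
  have hT : 32 * p ^ 2 ≤ 288 * N ^ 2 := by
    calc 32 * p ^ 2 ≤ 32 * (3 * N) ^ 2 := by gcongr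
      _ = _ := by ring
  have hb := fun (K : ℕ → Matrix (ZMod p) (ZMod p) ℝ)
    (hK : ∀ i, 1 ≤ i → K i ∈ holdingFamily p r ε) (x : ZMod p) =>
      holdingFamily_stepProd_bounds hp hr hr1 hs hε hε'.le hK x
  have key : ∀ K : ℕ → Matrix (ZMod p) (ZMod p) ℝ, (∀ i, 1 ≤ i → K i ∈ holdingFamily p r ε) →
      ∀ n : ℕ, timeBound B N η < n + 1 →
        maxTV K n < η ∧ maxRelDev K n ≤ ENNReal.ofReal η := by
    intro K hK n hn
    obtain ⟨k, hk, hkη⟩ := hblocks n hn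
    obtain ⟨h1, h2⟩ := maxTV_le_and_maxRelDev_le (u := c / p) (U := 3 / p)
      (fun K hK n x z => (hb K hK x).1 n z) (fun K hK n x => (hb K hK x).2.1 n)
      (fun K hK x z => ((hb K hK x).2.2 _ hT z).1) (fun K hK x z => ((hb K hK x).2.2 _ hT z).2)
      (by positivity) hK hk
    rw [ZMod.card, mul_div_cancel₀ _ hp0.ne'] at h1 h2
    have hpow : 0 ≤ (1 - c) ^ k := pow_nonneg (by linarith) k
    have h3 : 3 / (p : ℝ) / (c / p) = 3 / c := by field_simp
    have h12 : 12 ≤ 12 / c := by rw [le_div_iff₀ hc0]; linarith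
    constructor
    -- Strictness comes from `2 < 12 / c`, unless the power vanishes, when `0 < η` suffices.
    · refine h1.trans_lt ?_
      rcases hpow.eq_or_lt with h | h
      · rw [← h]; simpa using hη
      · nlinarith
    · refine h2.trans (ENNReal.ofReal_le_ofReal ?_)
      rw [h3]
      have : 12 / c = 4 * (3 / c) := by ring
      rw [this] at hkη
      have : 0 ≤ 3 / c * (1 - c) ^ k := by positivity
      linarith
  have hTB : 0 ≤ timeBound B N η := by
    have : 0 ≤ Real.posLog (1 / η) := Real.posLog_nonneg
    unfold timeBound
    positivity
  refine ⟨fun K hK => ⟨?_, fun t ht => (key K hK t (by linarith)).1.le⟩,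
    fun K hK n hn => (key K hK n (by linarith)).2⟩
  refine (iInf₂_le ⌊timeBound B N η⌋₊ (key K hK _ (Nat.lt_floor_add_one _)).1).trans ?_
  rw [← ENNReal.ofReal_natCast]
  exact ENNReal.ofReal_le_ofReal (Nat.floor_le hTB)

end Families

end CircleMerging
end

theorem theorem3p1 (ε : ℝ) (hε : 0 < ε) (hε' : ε < 1 / 2) :
    ∃ B : ℝ, 0 < B ∧
      (∀ (N : ℕ) [NeZero N], 2 ≤ N → ∀ η : ℝ, 0 < η →
        CircleMerging.HasTVMergingTimeAtMost (CircleMerging.lazyFamily (2 * N) ε) η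
          (CircleMerging.timeBound B N η) ∧
        ∀ K : ℕ → Matrix (ZMod (2 * N)) (ZMod (2 * N)) ℝ,
          (∀ i, 1 ≤ i → K i ∈ CircleMerging.lazyFamily (2 * N) ε) →
          ∀ n : ℕ, CircleMerging.timeBound B N η ≤ (n : ℝ) →
            CircleMerging.maxRelDev K n ≤ ENNReal.ofReal η) ∧
      (∀ N : ℕ, 1 ≤ N → ∀ η : ℝ, 0 < η →
        CircleMerging.HasTVMergingTimeAtMost (CircleMerging.family (2 * N + 1) ε) η
          (CircleMerging.timeBound B N η) ∧
        ∀ K : ℕ → Matrix (ZMod (2 * N + 1)) (ZMod (2 * N + 1)) ℝ,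
          (∀ i, 1 ≤ i → K i ∈ CircleMerging.family (2 * N + 1) ε) →
          ∀ n : ℕ, CircleMerging.timeBound B N η ≤ (n : ℝ) →
            CircleMerging.maxRelDev K n ≤ ENNReal.ofReal η) := by
  obtain ⟨B, hB, hblocks⟩ := CircleMerging.exists_blocks (c := (1 / 2 - ε) / 5)
    (by linarith) (by linarith)
  refine ⟨B, hB, ?_, ?_⟩
  · intro N _ hN η hη
    rw [CircleMerging.lazyFamily_eq]
    exact CircleMerging.holdingFamily_merging (by omega) le_rfl (by norm_num)
      (fun n hn => CircleMerging.sum_abs_symEigenvalue_pow_le_of_lazy hn) hε.le hε' (by omega)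
      hB hη (hblocks N (by omega) η hη)
  · intro N hN η hη
    rw [CircleMerging.family_eq]
    exact CircleMerging.holdingFamily_merging (by omega) (by norm_num) le_rfl
      (fun n hn => CircleMerging.sum_abs_symEigenvalue_pow_le_of_odd (odd_two_mul_add_one N) hn)
      hε.le hε' (by omega) hB hη (hblocks N (by omega) η hη)
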